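/- Let $N\ge 1$ be an odd integer. There exist real polynomials $x,y\in\mathbb R[t]$ with $\deg x=3$ and $\deg y=N+2\lfloor N/4\rfloor+1$ such that the plane curve $\mathcal C(t)=(x(t),y(t))$, $t\in\mathbb R$, has exactly $N$ crossing points (points $P\in\mathbb R^2$ with $\mathcal C(s)=\mathcal C(t)=P$ for some real $s\neq t$), and there are real numbers $$s_1<\cdots<s_N<t_1<\cdots<t_N$$ such that $\mathcal C(s_i)=\mathcal C(t_i)$ for $i=1,\dots,N$, and the pairs $(s_i,t_i)$ are the only pairs of real parameters $s<t$ with $\mathcal C(s)=\mathcal C(t)$. -/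

import Mathlib

/-- The parametrized plane curve `t ↦ (x(t), y(t))`, `t ∈ ℝ`, given by two real polynomials. -/
noncomputable def planeCurve (x y : Polynomial ℝ) (t : ℝ) : ℝ × ℝ :=
  (x.eval t, y.eval t)

/-- The crossing points (multiple points) of the parametrized curve `C`: the points of the plane
reached at two different real parameters. -/
def crossingPoints (C : ℝ → ℝ × ℝ) : Set (ℝ × ℝ) :=
  {P | ∃ s t : ℝ, s < t ∧ C s = P ∧ C t = P}

/-- The pairs of parameters `(s, t)`, `s < t`, at which `C` takes the same value. -/
def crossingParameters (C : ℝ → ℝ × ℝ) : Set (ℝ × ℝ) :=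
  {p | p.1 < p.2 ∧ C p.1 = C p.2}

/-! Take x = T₃ = 4X³ - 3X and N = 2M + 1. Parameters s < t satisfy x(s) = x(t) exactly when 4(s² +
st + t²) = 3, and then u = s + t lies in (-1, 1) and determines the pair. For y = `ordinatePoly A B`
the secant slope along this ellipse is u·h(1 - 2u²), with h(v) = A(T₃ v) + v B(T₃ v)
(`eval_ordinatePoly_sub`). Crossings thus come from u = 0 and from two values ±u for each zero of h
in (-1, 1). It remains to find such an h with exactly M zeros in [-1, 1], all just below 1, and with
A, B of the right degrees.

The building blocks are h_n = `oscPoly n`, with a zero of order exactly n at 1 and no other zero in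
[-1, 1]. Putting v = cos c and φ = 3c/2 turns sin c · h_n(cos c) into `osc a n φ`, where a depends
on the parity of n. The derivative of `osc a (n + 1)` is a multiple of sin φ · `osc a n`
(`hasDerivAt_osc_succ`), which gives both the sign and the order of vanishing by induction.

Finally the M-fold zero of h_M at 1 is split into M simple prescribed zeros by adding small
multiples of h_0, …, h_(M-1). Compactness and Rolle's theorem exclude further zeros
(`exists_combination_zeros_eq_nodes`). -/

/-! ### The functions `osc`: derivative, sign and growth at 0 -/

/-- The sequence `Im (exp (i a φ) (D n - i N n))`, where `N n / D n` is the `n`-th convergent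
of the continued fraction of `tan (a φ)` in powers of `tan φ`, cleared of denominators. -/
noncomputable def osc (a : ℝ) : ℕ → ℝ → ℝ
  | 0, φ => Real.sin (a * φ)
  | 1, φ => Real.cos φ * Real.sin (a * φ) - a * Real.sin φ * Real.cos (a * φ)
  | n + 2, φ => (2 * n + 3) * Real.cos φ * osc a (n + 1) φ +
      ((n + 1) ^ 2 - a ^ 2) * Real.sin φ ^ 2 * osc a n φ

theorem hasDerivAt_osc_zero (a φ : ℝ) :
    HasDerivAt (osc a 0) (a * Real.cos (a * φ)) φ := by
  have h : HasDerivAt (fun x : ℝ => a * x) a φ := by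
    simpa using (hasDerivAt_id φ).const_mul a
  have := h.sin
  rw [mul_comm] at this
  exact this.congr_of_eventuallyEq (Filter.Eventually.of_forall fun x => by simp [osc])

theorem hasDerivAt_osc_one (a φ : ℝ) :
    HasDerivAt (osc a 1) (-(1 - a ^ 2) * Real.sin φ * osc a 0 φ) φ := by
  have h : HasDerivAt (fun x : ℝ => a * x) a φ := by
    simpa using (hasDerivAt_id φ).const_mul a
  have h1 := ((Real.hasDerivAt_cos φ).mul h.sin).sub
    (((Real.hasDerivAt_sin φ).const_mul a).mul h.cos)
  refine (h1.congr_of_eventuallyEq (Filter.Eventually.of_forall fun x => ?_)).congr_deriv ?_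
  · simp [osc]
  · simp only [osc]; ring

theorem hasDerivAt_osc_add_two {a φ : ℝ} {n : ℕ} {y y' : ℝ}
    (h0 : HasDerivAt (osc a n) y φ) (h1 : HasDerivAt (osc a (n + 1)) y' φ) :
    HasDerivAt (osc a (n + 2))
      ((2 * n + 3) * (-Real.sin φ * osc a (n + 1) φ + Real.cos φ * y') +
        ((n + 1) ^ 2 - a ^ 2) * (2 * Real.sin φ * Real.cos φ * osc a n φ + Real.sin φ ^ 2 * y))
      φ := by
  have h := (((Real.hasDerivAt_cos φ).const_mul (2 * (n : ℝ) + 3)).mul h1).add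
    ((((Real.hasDerivAt_sin φ).pow 2).const_mul (((n : ℝ) + 1) ^ 2 - a ^ 2)).mul h0)
  refine (h.congr_of_eventuallyEq (Filter.Eventually.of_forall fun x => ?_)).congr_deriv ?_
  · simp [osc]
  · simp; ring

theorem hasDerivAt_osc_succ (a φ : ℝ) (n : ℕ) :
    HasDerivAt (osc a (n + 1)) (-((n + 1) ^ 2 - a ^ 2) * Real.sin φ * osc a n φ) φ := by
  induction n using Nat.twoStepInduction with
  | zero => simpa using hasDerivAt_osc_one a φ
  | one =>
    refine (hasDerivAt_osc_add_two (hasDerivAt_osc_zero a φ)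
      (hasDerivAt_osc_one a φ)).congr_deriv ?_
    simp only [osc]; push_cast; ring
  | more n ih0 ih1 =>
    refine (hasDerivAt_osc_add_two ih0 ih1).congr_deriv ?_
    simp only [osc]; push_cast; ring

theorem osc_at_zero (a : ℝ) (n : ℕ) : osc a n 0 = 0 := by
  induction n using Nat.twoStepInduction with
  | zero => simp [osc]
  | one => simp [osc]
  | more n ih0 ih1 => simp [osc, ih0, ih1]

theorem continuous_osc (a : ℝ) (n : ℕ) : Continuous (osc a n) := by
  rw [continuous_iff_continuousAt]
  intro φ
  cases n with
  | zero => exact (hasDerivAt_osc_zero a φ).continuousAt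
  | succ n => exact (hasDerivAt_osc_succ a φ n).continuousAt

theorem cos_three_pi_div_two : Real.cos (3 * Real.pi / 2) = 0 := by
  rw [show 3 * Real.pi / 2 = Real.pi / 2 + Real.pi by ring, Real.cos_add_pi]; simp

theorem sin_three_pi_div_two : Real.sin (3 * Real.pi / 2) = -1 := by
  rw [show 3 * Real.pi / 2 = Real.pi / 2 + Real.pi by ring, Real.sin_add_pi]; simp

theorem osc_add_two_three_pi_div_two (a : ℝ) (n : ℕ) :
    osc a (n + 2) (3 * Real.pi / 2) = ((n + 1) ^ 2 - a ^ 2) * osc a n (3 * Real.pi / 2) := by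
  simp [osc, cos_three_pi_div_two, sin_three_pi_div_two]

theorem sq_sub_sq_pos {a : ℝ} (h0 : 0 ≤ a) (h1 : a < 1) (n : ℕ) : 0 < ((n : ℝ) + 1) ^ 2 - a ^ 2 := by
  have : (0 : ℝ) ≤ n := n.cast_nonneg
  nlinarith

/-- The range of a places 3πa/2 in [π/2, π], where sine is nonnegative and cosine nonpositive; the
recurrence at 3π/2 then preserves the sign. -/
theorem osc_three_pi_div_two_nonneg {a : ℝ} (h0 : 1 / 3 ≤ a) (h1 : a ≤ 2 / 3) (n : ℕ) :
    0 ≤ (-1) ^ n * osc a n (3 * Real.pi / 2) := by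
  have hpi := Real.pi_pos
  induction n using Nat.twoStepInduction with
  | zero =>
    simp only [osc, pow_zero, one_mul]
    apply Real.sin_nonneg_of_nonneg_of_le_pi <;> nlinarith
  | one =>
    have : Real.cos (a * (3 * Real.pi / 2)) ≤ 0 := by
      apply Real.cos_nonpos_of_pi_div_two_le_of_le <;> nlinarith
    simp only [osc, cos_three_pi_div_two, sin_three_pi_div_two]
    nlinarith
  | more n ih0 _ =>
    rw [osc_add_two_three_pi_div_two, pow_add]
    have := mul_nonneg (sq_sub_sq_pos (by linarith) (by linarith : a < 1) n).le ih0
    linarith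

theorem hasDerivAt_neg_one_pow_mul_osc (a φ : ℝ) (n : ℕ) :
    HasDerivAt (fun x => (-1) ^ (n + 1) * osc a (n + 1) x)
      (((n + 1) ^ 2 - a ^ 2) * Real.sin φ * ((-1) ^ n * osc a n φ)) φ := by
  refine ((hasDerivAt_osc_succ a φ n).const_mul _).congr_deriv ?_
  rw [pow_succ]; ring

theorem neg_one_pow_mul_osc_pos {a : ℝ} (h0 : 1 / 3 ≤ a) (h1 : a ≤ 2 / 3) (n : ℕ) :
    ∀ φ ∈ Set.Ioo 0 (3 * Real.pi / 2), 0 < (-1) ^ n * osc a n φ := by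
  have hpi := Real.pi_pos
  induction n with
  | zero =>
    rintro φ ⟨hφ0, hφ1⟩
    simp only [osc, pow_zero, one_mul]
    apply Real.sin_pos_of_pos_of_lt_pi <;> nlinarith
  | succ n ih =>
    have hk := sq_sub_sq_pos (by linarith) (by linarith : a < 1) n
    set w : ℝ → ℝ := fun x => (-1) ^ (n + 1) * osc a (n + 1) x with hw
    have hd := fun φ => hasDerivAt_neg_one_pow_mul_osc a φ n
    have hc : Continuous w := continuous_const.mul (continuous_osc a (n + 1))
    -- The derivative has the sign of sin φ: `w` rises from 0 up to φ = π, then falls to an endpoint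
    -- value that is still nonnegative.
    have hmono : StrictMonoOn w (Set.Icc 0 Real.pi) := by
      refine strictMonoOn_of_deriv_pos (convex_Icc _ _) hc.continuousOn fun x hx => ?_
      rw [interior_Icc] at hx
      rw [(hd x).deriv]
      exact mul_pos (mul_pos hk (Real.sin_pos_of_pos_of_lt_pi hx.1 hx.2))
        (ih x ⟨hx.1, by linarith [hx.2]⟩)
    have hanti : StrictAntiOn w (Set.Icc Real.pi (3 * Real.pi / 2)) := by
      refine strictAntiOn_of_deriv_neg (convex_Icc _ _) hc.continuousOn fun x hx => ?_
      rw [interior_Icc] at hx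
      rw [(hd x).deriv]
      have hs : Real.sin x < 0 := by
        have := Real.sin_pos_of_pos_of_lt_pi (x := x - Real.pi) (by linarith [hx.1])
          (by linarith [hx.2])
        rw [Real.sin_sub_pi] at this; linarith
      exact mul_neg_of_neg_of_pos (mul_neg_of_pos_of_neg hk hs)
        (ih x ⟨by linarith [hx.1], hx.2⟩)
    rintro φ ⟨hφ0, hφ1⟩
    change 0 < w φ
    rcases le_total φ Real.pi with h | h
    · have h2 := hmono ⟨le_rfl, hpi.le⟩ ⟨hφ0.le, h⟩ hφ0
      simpa [hw, osc_at_zero] using h2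
    · have h2 := hanti ⟨h, hφ1.le⟩ ⟨by linarith, le_rfl⟩ hφ1
      exact lt_of_le_of_lt (osc_three_pi_div_two_nonneg h0 h1 (n + 1)) h2

theorem neg_one_pow_mul_osc_bounds {a : ℝ} (h0 : 1 / 3 ≤ a) (h1 : a ≤ 2 / 3) (n : ℕ) :
    ∃ m K : ℝ, 0 < m ∧ 0 < K ∧ ∀ φ ∈ Set.Icc (0 : ℝ) 1,
      m * φ ^ (2 * n + 1) ≤ (-1) ^ n * osc a n φ ∧
      (-1) ^ n * osc a n φ ≤ K * φ ^ (2 * n + 1) := by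
  induction n with
  | zero =>
    -- The factor 2/π is that of Jordan's inequality 2x/π ≤ sin x, used again in each induction step
    -- to compare derivatives.
    refine ⟨2 / Real.pi * a, a, by have := Real.pi_pos; positivity, by linarith, ?_⟩
    rintro φ ⟨hφ0, hφ1⟩
    have h3 := Real.pi_gt_three
    simp only [osc, pow_zero, one_mul, mul_zero, zero_add, pow_one]
    constructor
    · have := Real.mul_le_sin (x := a * φ) (by nlinarith) (by nlinarith)
      linarith
    · exact Real.sin_le (by nlinarith)
  | succ n ih =>
    obtain ⟨m, K, hm, hK, h⟩ := ih
    have hk := sq_sub_sq_pos (by linarith) (by linarith : a < 1) n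
    set κ := ((n : ℝ) + 1) ^ 2 - a ^ 2 with hκ
    have hn : (0 : ℝ) < 2 * n + 3 := by positivity
    have hpi := Real.pi_pos
    have hd := fun φ => hasDerivAt_neg_one_pow_mul_osc a φ n
    have hp : ∀ (r x : ℝ), HasDerivAt (fun x : ℝ => r / (2 * n + 3) * x ^ (2 * (n + 1) + 1))
        (r * (x * x ^ (2 * n + 1))) x := by
      intro r x
      refine ((hasDerivAt_pow (2 * (n + 1) + 1) x).const_mul (r / (2 * n + 3))).congr_deriv ?_
      push_cast
      have : (2 * ((n : ℝ) + 1) + 1) = 2 * n + 3 := by ring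
      rw [this]
      field_simp
      ring
    have hmono : ∀ F F' : ℝ → ℝ, (∀ x, HasDerivAt F (F' x) x) → F 0 = 0 →
        (∀ x ∈ Set.Ioo (0 : ℝ) 1, 0 ≤ F' x) → ∀ x ∈ Set.Icc (0 : ℝ) 1, 0 ≤ F x := by
      intro F F' hF h00 hF' x hx
      have : MonotoneOn F (Set.Icc 0 1) := by
        refine monotoneOn_of_deriv_nonneg (convex_Icc _ _)
          (fun x _ => (hF x).continuousAt.continuousWithinAt)
          (fun x _ => (hF x).differentiableAt.differentiableWithinAt) fun y hy => ?_
        rw [interior_Icc] at hy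
        rw [(hF y).deriv]; exact hF' y hy
      simpa [h00] using this ⟨le_rfl, zero_le_one⟩ hx hx.1
    refine ⟨κ * (2 / Real.pi) * m / (2 * n + 3), κ * K / (2 * n + 3), by positivity,
      by positivity, fun φ hφ => ⟨?_, ?_⟩⟩
    · have := hmono _ _ (fun x => (hd x).sub (hp (κ * (2 / Real.pi) * m) x))
        (by simp [osc_at_zero]) (fun x hx => ?_) φ hφ
      · simpa using this
      · have h3 := Real.pi_gt_three
        have hs := Real.mul_le_sin hx.1.le (by linarith [hx.2])
        have := mul_le_mul hs (h x ⟨hx.1.le, hx.2.le⟩).1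
          (by have := hx.1; positivity) (le_trans (by have := hx.1; positivity) hs)
        have := mul_le_mul_of_nonneg_left this hk.le
        linarith
    · have := hmono _ _ (fun x => (hp (κ * K) x).sub (hd x))
        (by simp [osc_at_zero]) (fun x hx => ?_) φ hφ
      · simpa using this
      · have hs := Real.sin_le hx.1.le
        have hb := h x ⟨hx.1.le, hx.2.le⟩
        have := mul_le_mul hs hb.2
          (le_trans (by have := hx.1; positivity) hb.1) hx.1.le
        have := mul_le_mul_of_nonneg_left this hk.le
        linarith
-- Trigonometric polynomial form of `osc` and its degrees
open Polynomial

/-- The pair `(A, B)` of polynomials in `cos (2 φ)` expressing `osc a n φ` through two sines, see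
`osc_eq_oscPair`. -/
noncomputable def oscPair (a : ℝ) : ℕ → ℝ[X] × ℝ[X]
  | 0 => (1, 0)
  | 1 => (C (-(1 + a) / 2), C (1 - a))
  | n + 2 =>
    (C (2 * (n : ℝ) + 3) *
        (C (-1 / 2) * (oscPair a (n + 1)).1 + (C (1 / 2) * X + C (1 / 4)) * (oscPair a (n + 1)).2) +
      C ((((n : ℝ) + 1) ^ 2 - a ^ 2) / 2) * (1 - X) * (oscPair a n).1,
     C (2 * (n : ℝ) + 3) * ((oscPair a (n + 1)).1 + C (1 / 2) * (oscPair a (n + 1)).2) +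
      C ((((n : ℝ) + 1) ^ 2 - a ^ 2) / 2) * (1 - X) * (oscPair a n).2)

/-- The lower frequency occurring in `osc_eq_oscPair`. -/
noncomputable def oscFreq (a : ℝ) (n : ℕ) : ℝ := if Even n then a else 1 - a

theorem oscFreq_succ (a : ℝ) (n : ℕ) : oscFreq a (n + 1) = 1 - oscFreq a n := by
  unfold oscFreq
  by_cases h : Even n
  · have : ¬ Even (n + 1) := by simpa [Nat.even_add_one] using h
    simp [h, this]
  · have : Even (n + 1) := by simpa [Nat.even_add_one] using h
    simp [h, this]

/-- Multiplication by cos φ sends the frequencies 1 - b, 1 + b to b, 2 - b and 2 + b, and sin((2 +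
b)φ) = 2 cos(2φ) sin(bφ) + sin((2 - b)φ) absorbs the last one. -/
theorem osc_eq_oscPair (a : ℝ) (n : ℕ) (φ : ℝ) :
    osc a n φ = (oscPair a n).1.eval (Real.cos (2 * φ)) * Real.sin (oscFreq a n * φ) +
      (oscPair a n).2.eval (Real.cos (2 * φ)) / 2 * Real.sin ((2 - oscFreq a n) * φ) := by
  induction n using Nat.twoStepInduction with
  | zero => simp [osc, oscPair, oscFreq]
  | one =>
    have h1 : (1 - a) * φ = φ - a * φ := by ring
    have h2 : (2 - (1 - a)) * φ = φ + a * φ := by ring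
    simp only [osc, oscPair, oscFreq, Nat.not_even_one, if_false, eval_C, h1, h2, Real.sin_sub,
      Real.sin_add]
    ring
  | more n ih0 ih1 =>
    rw [osc, ih0, ih1, oscFreq_succ a (n + 1), oscFreq_succ a n]
    set b := oscFreq a n
    have h1 : (1 - b) * φ = φ - b * φ := by ring
    have h2 : (2 - (1 - b)) * φ = φ + b * φ := by ring
    have h3 : (1 - (1 - b)) * φ = b * φ := by ring
    have h4 : (2 - (1 - (1 - b))) * φ = 2 * φ - b * φ := by ring
    have h5 : (2 - b) * φ = 2 * φ - b * φ := by ring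
    rw [h1, h2, h3, h4, h5]
    simp only [oscPair, eval_add, eval_mul, eval_C, eval_X, eval_sub, eval_one, Real.sin_sub,
      Real.sin_add, Real.sin_two_mul]
    have h6 : Real.sin φ ^ 2 = (1 - Real.cos (2 * φ)) / 2 := by
      rw [Real.cos_two_mul, Real.sin_sq]; ring
    have h7 : Real.cos φ ^ 2 = (1 + Real.cos (2 * φ)) / 2 := by
      rw [Real.cos_two_mul]; ring
    generalize Real.cos (2 * φ) = x at *
    linear_combination (((n : ℝ) + 1) ^ 2 - a ^ 2) * (eval x (oscPair a n).1 * Real.sin (b * φ) +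
      eval x (oscPair a n).2 / 2 *
        (2 * Real.sin φ * Real.cos φ * Real.cos (b * φ) - x * Real.sin (b * φ))) * h6 +
      (2 * n + 3) * (-eval x (oscPair a (n + 1)).1 + eval x (oscPair a (n + 1)).2 / 2) *
        Real.sin (b * φ) * h7

theorem oscPair_coeff_eq_zero (a : ℝ) (n : ℕ) :
    (∀ i, n < 2 * i → (oscPair a n).1.coeff i = 0) ∧
      ∀ i, n < 2 * i + 1 → (oscPair a n).2.coeff i = 0 := by
  induction n using Nat.twoStepInduction with
  | zero =>
    refine ⟨fun i hi => ?_, fun i _ => by simp [oscPair]⟩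
    simp only [oscPair, coeff_one]
    rw [if_neg (by omega)]
  | one =>
    refine ⟨fun i hi => ?_, fun i hi => ?_⟩ <;>
    · simp only [oscPair, coeff_C]
      rw [if_neg (by omega)]
  | more n ih0 ih1 =>
    refine ⟨fun i hi => ?_, fun i hi => ?_⟩
    · obtain ⟨i, rfl⟩ : ∃ j, i = j + 1 := ⟨i - 1, by omega⟩
      simp only [oscPair, coeff_add, coeff_C_mul, add_mul, mul_assoc, sub_mul, one_mul, coeff_sub,
        coeff_X_mul]
      rw [ih1.1 _ (by omega), ih1.2 _ (by omega), ih1.2 _ (by omega), ih0.1 _ (by omega),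
        ih0.1 _ (by omega)]
      ring
    · obtain ⟨i, rfl⟩ : ∃ j, i = j + 1 := ⟨i - 1, by omega⟩
      simp only [oscPair, coeff_add, coeff_C_mul, add_mul, mul_assoc, sub_mul, one_mul, coeff_sub,
        coeff_X_mul]
      rw [ih1.1 _ (by omega), ih1.2 _ (by omega), ih0.2 _ (by omega), ih0.2 _ (by omega)]
      ring

/-- The top coefficients at even and odd indices feed each other through the recurrence, with
factors that are positive because a < 1. -/
theorem oscPair_leading_coeff {a : ℝ} (ha : a < 1) (k : ℕ) :
    (oscPair a (2 * k)).1.coeff k ≠ 0 ∧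
      (oscPair a (2 * k + 1)).2.coeff k = (2 * k + 1 - a) * (oscPair a (2 * k)).1.coeff k := by
  induction k with
  | zero => simp [oscPair]
  | succ k ih =>
    have hk : (0 : ℝ) ≤ k := k.cast_nonneg
    have h1 := oscPair_coeff_eq_zero a (2 * k)
    have h2 := oscPair_coeff_eq_zero a (2 * k + 1)
    have h3 := oscPair_coeff_eq_zero a (2 * k + 2)
    have e1 : (oscPair a (2 * k + 2)).1.coeff (k + 1) =
        (2 * k + 1 - a) * (2 * k + 2 - a) / 2 * (oscPair a (2 * k)).1.coeff k := by
      rw [oscPair]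
      simp only [coeff_add, coeff_C_mul, add_mul, mul_assoc, sub_mul, one_mul, coeff_sub,
        coeff_X_mul]
      rw [h2.1 _ (by omega), ih.2, h2.2 _ (by omega), h1.1 (k + 1) (by omega)]
      push_cast
      ring
    have e2 : (oscPair a (2 * k + 1 + 2)).2.coeff (k + 1) =
        (2 * k + 3 - a) * (oscPair a (2 * k + 2)).1.coeff (k + 1) := by
      rw [oscPair]
      simp only [coeff_add, coeff_C_mul, add_mul, mul_assoc, sub_mul, one_mul, coeff_sub,
        coeff_X_mul]
      rw [h3.2 _ (by omega), ih.2, h2.2 _ (by omega), e1]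
      push_cast
      ring
    refine ⟨?_, ?_⟩
    · rw [show 2 * (k + 1) = 2 * k + 2 by ring, e1]
      refine mul_ne_zero ?_ ih.1
      have : 0 < (2 * k + 1 - a) * (2 * k + 2 - a) / 2 := by
        apply div_pos (mul_pos _ _) two_pos <;> linarith
      exact this.ne'
    · rw [show 2 * (k + 1) + 1 = 2 * k + 1 + 2 by ring, e2]
      rw [show 2 * (k + 1) = 2 * k + 2 by ring]
      push_cast
      ring

/-! ### The polynomials `oscPoly` and their zeros in [-1, 1) -/

/-- The parameter `a` for which `sin c` and `sin (2 c)` are the sines occurring in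
`osc a n (3 c / 2)`. -/
noncomputable def oscSlope (n : ℕ) : ℝ := if Even n then 2 / 3 else 1 / 3

theorem oscSlope_mem (n : ℕ) : 1 / 3 ≤ oscSlope n ∧ oscSlope n ≤ 2 / 3 := by
  unfold oscSlope; split_ifs <;> norm_num

theorem oscFreq_oscSlope (n : ℕ) : oscFreq (oscSlope n) n = 2 / 3 := by
  unfold oscSlope oscFreq; split_ifs <;> norm_num

/-- The polynomial `A (T₃ v) + v B (T₃ v)`, where `T₃` is the third Chebyshev polynomial. -/
noncomputable def chebCombine (A B : ℝ[X]) : ℝ[X] :=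
  A.comp (4 * X ^ 3 - 3 * X) + X * B.comp (4 * X ^ 3 - 3 * X)

theorem eval_chebCombine (A B : ℝ[X]) (v : ℝ) :
    (chebCombine A B).eval v =
      A.eval (4 * v ^ 3 - 3 * v) + v * B.eval (4 * v ^ 3 - 3 * v) := by
  simp [chebCombine, eval_comp]

/-- The polynomial `h` with `sin c * h (cos c) = osc a n (3 c / 2)`, for `a = oscSlope n`. -/
noncomputable def oscPoly (n : ℕ) : ℝ[X] :=
  chebCombine (oscPair (oscSlope n) n).1 (oscPair (oscSlope n) n).2

theorem sin_mul_eval_oscPoly (n : ℕ) (c : ℝ) :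
    Real.sin c * (oscPoly n).eval (Real.cos c) = osc (oscSlope n) n (3 * c / 2) := by
  rw [osc_eq_oscPair, oscFreq_oscSlope, oscPoly, eval_chebCombine, ← Real.cos_three_mul,
    show 2 * (3 * c / 2) = 3 * c by ring, show 2 / 3 * (3 * c / 2) = c by ring,
    show (2 - 2 / 3) * (3 * c / 2) = 2 * c by ring, Real.sin_two_mul]
  ring

theorem osc_two_thirds_ne_zero (k : ℕ) : osc (2 / 3) (2 * k + 1) (3 * Real.pi / 2) ≠ 0 := by
  induction k with
  | zero =>
    simp only [osc, cos_three_pi_div_two, sin_three_pi_div_two]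
    rw [show 2 / 3 * (3 * Real.pi / 2) = Real.pi by ring]
    norm_num
  | succ k ih =>
    rw [show 2 * (k + 1) + 1 = 2 * k + 1 + 2 by ring, osc_add_two_three_pi_div_two]
    exact mul_ne_zero (sq_sub_sq_pos (by norm_num) (by norm_num) _).ne' ih

theorem osc_one_third_ne_zero (k : ℕ) : osc (1 / 3) (2 * k) (3 * Real.pi / 2) ≠ 0 := by
  induction k with
  | zero =>
    simp only [osc]
    rw [show 1 / 3 * (3 * Real.pi / 2) = Real.pi / 2 by ring]
    norm_num
  | succ k ih =>
    rw [show 2 * (k + 1) = 2 * k + 2 by ring, osc_add_two_three_pi_div_two]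
    exact mul_ne_zero (sq_sub_sq_pos (by norm_num) (by norm_num) _).ne' ih

theorem osc_oscSlope_succ_ne_zero (n : ℕ) :
    osc (oscSlope (n + 1)) n (3 * Real.pi / 2) ≠ 0 := by
  rcases Nat.even_or_odd' n with ⟨k, rfl | rfl⟩
  · have : oscSlope (2 * k + 1) = 1 / 3 := by simp [oscSlope]
    rw [this]; exact osc_one_third_ne_zero k
  · have : oscSlope (2 * k + 1 + 1) = 2 / 3 := by
      simp [oscSlope, show 2 * k + 1 + 1 = 2 * (k + 1) by ring]
    rw [this]; exact osc_two_thirds_ne_zero k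

/-- At c = π the factor sin c vanishes, so the identity itself says nothing about the value at -1.
Differentiating it there does: a zero of h at -1 would force `osc a n` to vanish at 3π/2. -/
theorem eval_neg_one_oscPoly_ne_zero (n : ℕ) : (oscPoly n).eval (-1) ≠ 0 := by
  cases n with
  | zero => simp [oscPoly, oscPair, chebCombine]
  | succ n =>
    intro h
    have h1 : HasDerivAt (fun c : ℝ => 3 * c / 2) (3 / 2) Real.pi := by
      simpa using ((hasDerivAt_id Real.pi).const_mul 3).div_const 2
    have h2 := (hasDerivAt_osc_succ (oscSlope (n + 1)) (3 * Real.pi / 2) n).comp Real.pi h1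
    have h3 := (Real.hasDerivAt_sin Real.pi).mul
      (((oscPoly (n + 1)).hasDerivAt (Real.cos Real.pi)).comp Real.pi
        (Real.hasDerivAt_cos Real.pi))
    have h4 : (Real.sin * (fun x => eval x (oscPoly (n + 1))) ∘ Real.cos) =
        osc (oscSlope (n + 1)) (n + 1) ∘ fun c : ℝ => 3 * c / 2 := by
      funext c
      exact sin_mul_eval_oscPoly (n + 1) c
    rw [h4] at h3
    have h5 := h2.unique h3
    simp only [sin_three_pi_div_two, Function.comp, Real.cos_pi, Real.sin_pi, h] at h5
    have hk := sq_sub_sq_pos (a := oscSlope (n + 1)) (by linarith [(oscSlope_mem (n + 1)).1])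
      (by linarith [(oscSlope_mem (n + 1)).2]) n
    have := mul_ne_zero hk.ne' (osc_oscSlope_succ_ne_zero n)
    apply this
    linarith

theorem eval_oscPoly_ne_zero (n : ℕ) {v : ℝ} (hv : v ∈ Set.Ico (-1 : ℝ) 1) :
    (oscPoly n).eval v ≠ 0 := by
  rcases hv.1.eq_or_lt with rfl | h
  · exact eval_neg_one_oscPoly_ne_zero n
  · intro h0
    have h1 := sin_mul_eval_oscPoly n (Real.arccos v)
    rw [Real.cos_arccos hv.1 hv.2.le, h0, mul_zero] at h1
    have h2 : 0 < Real.arccos v := Real.arccos_pos.2 hv.2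
    have h3 : Real.arccos v < Real.pi := by
      refine lt_of_le_of_ne (Real.arccos_le_pi v) fun h4 => ?_
      rw [Real.arccos_eq_pi] at h4; linarith
    have h4 := neg_one_pow_mul_osc_pos (oscSlope_mem n).1 (oscSlope_mem n).2 n
      (3 * Real.arccos v / 2) ⟨by linarith, by linarith⟩
    rw [← h1] at h4
    simp at h4

/-! ### Order of vanishing of `oscPoly` at 1 -/

open Asymptotics Filter Topology in
theorem le_of_pow_isBigO_pow {p q : ℕ}
    (h : (fun c : ℝ => c ^ p) =O[𝓝[>] 0] fun c : ℝ => c ^ q) : q ≤ p := by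
  by_contra! hlt
  have h1 : (fun c : ℝ => c ^ q) =o[𝓝[>] 0] fun c : ℝ => c ^ p :=
    (isLittleO_pow_pow hlt).mono nhdsWithin_le_nhds
  refine isLittleO_irrefl' ?_ (h.trans_isLittleO h1)
  refine Eventually.frequently ?_
  filter_upwards [self_mem_nhdsWithin] with c hc
  have : c ≠ 0 := ne_of_gt hc
  simp [this]

open Asymptotics Filter Topology in
theorem osc_isTheta (n : ℕ) :
    (fun c : ℝ => osc (oscSlope n) n (3 * c / 2)) =Θ[𝓝[>] 0] fun c : ℝ => c ^ (2 * n + 1) := by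
  obtain ⟨m, K, hm, hK, h⟩ := neg_one_pow_mul_osc_bounds (oscSlope_mem n).1 (oscSlope_mem n).2 n
  have hev : ∀ᶠ c : ℝ in 𝓝[>] 0, 0 ≤ c ∧ 3 * c / 2 ∈ Set.Icc (0 : ℝ) 1 := by
    filter_upwards [Ioo_mem_nhdsGT (show (0 : ℝ) < 2 / 3 by norm_num)] with c hc
    exact ⟨hc.1.le, by linarith [hc.1], by linarith [hc.2]⟩
  have habs : ∀ y : ℝ, 0 ≤ (-1) ^ n * y → |y| = (-1) ^ n * y := by
    intro y hy
    rw [← abs_of_nonneg hy, abs_mul]; simp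
  have hpos : ∀ c : ℝ, 3 * c / 2 ∈ Set.Icc (0 : ℝ) 1 →
      0 ≤ (-1) ^ n * osc (oscSlope n) n (3 * c / 2) := fun c hc =>
    le_trans (mul_nonneg hm.le (pow_nonneg hc.1 _)) (h _ hc).1
  constructor
  · refine IsBigO.of_bound (K * (3 / 2) ^ (2 * n + 1)) ?_
    filter_upwards [hev] with c ⟨hc0, hc⟩
    rw [Real.norm_eq_abs, habs _ (hpos c hc), Real.norm_eq_abs, abs_of_nonneg (pow_nonneg hc0 _)]
    refine (h _ hc).2.trans (le_of_eq ?_)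
    rw [show 3 * c / 2 = 3 / 2 * c by ring, mul_pow]; ring
  · refine IsBigO.of_bound (m * (3 / 2) ^ (2 * n + 1))⁻¹ ?_
    filter_upwards [hev] with c ⟨hc0, hc⟩
    rw [Real.norm_eq_abs, Real.norm_eq_abs, habs _ (hpos c hc), abs_of_nonneg (pow_nonneg hc0 _),
      le_inv_mul_iff₀ (by positivity)]
    refine le_trans (le_of_eq ?_) (h _ hc).1
    rw [show 3 * c / 2 = 3 / 2 * c by ring, mul_pow]; ring

theorem oscPoly_ne_zero (n : ℕ) : oscPoly n ≠ 0 := fun h =>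
  eval_neg_one_oscPoly_ne_zero n (by simp [h])

-- A zero of order j at v = 1 makes sin c · h(cos c) of exact order c^(2j+1), since cos c - 1 has
-- order c²; this is compared with the order c^(2n+1) of `osc`.
open Asymptotics Filter Topology in
theorem rootMultiplicity_one_oscPoly (n : ℕ) : (oscPoly n).rootMultiplicity 1 = n := by
  obtain ⟨g, hg, hg1⟩ := exists_eq_pow_rootMultiplicity_mul_and_not_dvd _ (oscPoly_ne_zero n) 1
  set j := (oscPoly n).rootMultiplicity 1
  rw [dvd_iff_isRoot, IsRoot.def] at hg1
  have hid : Tendsto (fun c : ℝ => c / 2) (𝓝 0) (𝓝 0) := by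
    simpa using (continuous_id.div_const (2 : ℝ)).tendsto 0
  have hsin : Real.sin =Θ[𝓝 0] fun c : ℝ => c :=
    Real.isEquivalent_sin.isTheta
  have hcos : (fun c : ℝ => Real.cos c - 1) =Θ[𝓝 0] fun c : ℝ => c ^ 2 := by
    have h1 : (fun c : ℝ => Real.cos c - 1) = fun c => (-2 : ℝ) * Real.sin (c / 2) ^ 2 := by
      funext c
      have := Real.cos_sq (c / 2)
      rw [Real.sin_sq, this, show 2 * (c / 2) = c by ring]; ring
    rw [h1]
    refine IsTheta.const_mul_left (by norm_num) ?_
    have h2 : (fun c : ℝ => Real.sin (c / 2)) =Θ[𝓝 0] fun c : ℝ => c := by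
      have h3 : (fun c : ℝ => Real.sin (c / 2)) =Θ[𝓝 0] fun c : ℝ => c / 2 :=
        ⟨hsin.1.comp_tendsto hid, hsin.2.comp_tendsto hid⟩
      refine h3.trans ?_
      simp only [div_eq_inv_mul]
      exact IsTheta.const_mul_left (by norm_num) (isTheta_refl _ _)
    exact h2.pow 2
  have hgc : (fun c : ℝ => g.eval (Real.cos c)) =Θ[𝓝 0] fun _ : ℝ => (1 : ℝ) := by
    have ht : Tendsto (fun c : ℝ => g.eval (Real.cos c)) (𝓝 0) (𝓝 (g.eval 1)) := by
      have := (g.continuous.comp Real.continuous_cos).tendsto 0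
      simpa [Function.comp_def] using this
    exact (isTheta_of_div_tendsto_nhds_ne_zero (by simpa using ht) hg1).symm
  have h1 : (fun c : ℝ => Real.sin c * ((Real.cos c - 1) ^ j * g.eval (Real.cos c))) =Θ[𝓝 0]
      fun c : ℝ => c * ((c ^ 2) ^ j * 1) := hsin.mul ((hcos.pow j).mul hgc)
  have h2 : (fun c : ℝ => Real.sin c * ((Real.cos c - 1) ^ j * g.eval (Real.cos c))) =
      fun c => osc (oscSlope n) n (3 * c / 2) := by
    funext c
    rw [← sin_mul_eval_oscPoly, hg]
    simp
  have h3 : (fun c : ℝ => c * ((c ^ 2) ^ j * 1)) = fun c => c ^ (2 * j + 1) := by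
    funext c; ring
  rw [h2, h3] at h1
  have h4 : (fun c : ℝ => c ^ (2 * j + 1)) =Θ[𝓝[>] 0] fun c : ℝ => c ^ (2 * n + 1) :=
    IsTheta.trans ⟨h1.2.mono nhdsWithin_le_nhds, h1.1.mono nhdsWithin_le_nhds⟩ (osc_isTheta n)
  have h5 := le_of_pow_isBigO_pow h4.1
  have h6 := le_of_pow_isBigO_pow h4.2
  omega

/-! ### Splitting a multiple zero into prescribed simple ones -/

/-- Iterated Rolle theorem for polynomials. -/
theorem exists_eval_iterate_derivative_eq_zero (r : ℕ) (p : ℝ[X]) {a b : ℝ} (s : Finset ℝ)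
    (hs : r < s.card) (h : ∀ x ∈ s, x ∈ Set.Icc a b ∧ p.eval x = 0) :
    ∃ x ∈ Set.Icc a b, (derivative^[r] p).eval x = 0 := by
  suffices H : ∀ (r : ℕ) (p : ℝ[X]) (z : Fin (r + 1) → ℝ), StrictMono z →
      (∀ i, z i ∈ Set.Icc a b ∧ p.eval (z i) = 0) →
      ∃ x ∈ Set.Icc a b, (derivative^[r] p).eval x = 0 from
    H r p (s.orderEmbOfFin rfl ∘ Fin.castLE hs)
      ((s.orderEmbOfFin rfl).strictMono.comp (Fin.strictMono_castLE hs))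
      fun i => h _ (s.orderEmbOfFin_mem rfl _)
  intro r
  induction r with
  | zero => exact fun p z _ hz => ⟨z 0, (hz 0).1, by simpa using (hz 0).2⟩
  | succ r ih =>
    intro p z hz h
    have hR : ∀ i : Fin (r + 1), ∃ y ∈ Set.Ioo (z i.castSucc) (z i.succ),
        (derivative p).eval y = 0 := by
      intro i
      obtain ⟨y, hy, hy'⟩ := exists_deriv_eq_zero (f := fun x => p.eval x)
        (hz (Fin.castSucc_lt_succ (i := i))) p.continuous.continuousOn
        ((h _).2.trans (h _).2.symm)
      exact ⟨y, hy, by simpa using hy'⟩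
    choose y hy hy' using hR
    refine ih (derivative p) y (Fin.strictMono_iff_lt_succ.2 fun i => ?_) fun i => ⟨⟨?_, ?_⟩, hy' i⟩
    · exact (hy i.castSucc).2.trans (by rw [Fin.succ_castSucc]; exact (hy i.succ).1)
    · exact (h _).1.1.trans (hy i).1.le
    · exact (hy i).2.le.trans (h _).1.2

/-- The nodes `1 - 2 (ε i) ^ 2`, `1 ≤ i ≤ M`. -/
noncomputable def nodes (M : ℕ) (ε : ℝ) : Finset ℝ :=
  (Finset.Icc 1 M).image fun i : ℕ => 1 - 2 * (ε * i) ^ 2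

theorem card_nodes (M : ℕ) {ε : ℝ} (hε : 0 < ε) : (nodes M ε).card = M := by
  rw [nodes, Finset.card_image_of_injective, Nat.card_Icc, Nat.add_sub_cancel]
  intro i j hij
  have h1 : (ε * i) ^ 2 = (ε * j) ^ 2 := by simpa using hij
  rw [sq_eq_sq₀ (by positivity) (by positivity)] at h1
  exact_mod_cast mul_left_cancel₀ hε.ne' h1

theorem mem_Icc_of_mem_nodes {M : ℕ} {ε x : ℝ} (hε : 0 < ε) (hx : x ∈ nodes M ε) :
    x ∈ Set.Icc (1 - 2 * (ε * M) ^ 2) 1 := by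
  obtain ⟨i, hi, rfl⟩ := Finset.mem_image.1 hx
  have hi' : (i : ℝ) ≤ M := by exact_mod_cast (Finset.mem_Icc.1 hi).2
  have : (ε * i) ^ 2 ≤ (ε * M) ^ 2 := by gcongr
  exact ⟨by linarith, by nlinarith [sq_nonneg (ε * i)]⟩

/-- At most M linear conditions on M + 1 unknowns have a nonzero solution; normalizing it keeps the
coefficients in a compact set. -/
theorem exists_combination_eval_eq_zero {M : ℕ} (h : ℕ → ℝ[X]) (s : Finset ℝ) (hs : s.card ≤ M) :
    ∃ c : Fin (M + 1) → ℝ, ‖c‖ = 1 ∧ ∀ x ∈ s, ∑ n, c n * (h n).eval x = 0 := by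
  let L : (Fin (M + 1) → ℝ) →ₗ[ℝ] (s → ℝ) :=
    LinearMap.pi fun x => ∑ n : Fin (M + 1), (h n).eval (x : ℝ) • LinearMap.proj n
  have hL : ∀ c x, L c x = ∑ n, c n * (h n).eval (x : ℝ) := by
    intro c x
    simp [L, mul_comm]
  have hk : LinearMap.ker L ≠ ⊥ := by
    apply LinearMap.ker_ne_bot_of_finrank_lt
    simpa using Nat.lt_succ_of_le hs
  obtain ⟨c, hc, hc0⟩ := Submodule.exists_mem_ne_zero_of_ne_bot hk
  refine ⟨‖c‖⁻¹ • c, norm_smul_inv_norm hc0, fun x hx => ?_⟩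
  have h1 : L (‖c‖⁻¹ • c) = 0 := by
    rw [map_smul, LinearMap.mem_ker.1 hc, smul_zero]
  rw [← hL _ ⟨x, hx⟩, h1]; rfl

theorem iterate_derivative_sum {M : ℕ} (h : ℕ → ℝ[X]) (c : Fin (M + 1) → ℝ) (i : ℕ) (x : ℝ) :
    (derivative^[i] (∑ n, C (c n) * h n)).eval x = ∑ n, c n * (derivative^[i] (h n)).eval x := by
  rw [Polynomial.iterate_derivative_sum, eval_finsetSum]
  simp [Polynomial.iterate_derivative_C_mul]

-- More than r zeros squeezed towards 1 leave, by Rolle, a zero of the r-th derivative that tends to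
-- 1; continuity passes this to the limit.
open Filter Topology in
theorem sum_iterate_derivative_eq_zero_of_tendsto {M r : ℕ} (h : ℕ → ℝ[X])
    {c : ℕ → Fin (M + 1) → ℝ} {c' : Fin (M + 1) → ℝ} (hc : Tendsto c atTop (𝓝 c'))
    {a : ℕ → ℝ} (ha : Tendsto a atTop (𝓝 1))
    (hz : ∀ᶠ j in atTop, ∃ s : Finset ℝ, r < s.card ∧
      ∀ x ∈ s, x ∈ Set.Icc (a j) 1 ∧ ∑ n, c j n * (h n).eval x = 0) :
    ∑ n, c' n * (derivative^[r] (h n)).eval 1 = 0 := by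
  have h1 : ∀ᶠ j in atTop, ∃ x ∈ Set.Icc (a j) 1,
      ∑ n, c j n * (derivative^[r] (h n)).eval x = 0 := by
    filter_upwards [hz] with j ⟨s, hs, hx⟩
    obtain ⟨x, hx, hx0⟩ := exists_eval_iterate_derivative_eq_zero r
      (∑ n, C (c j n) * h n) s hs fun x hxs => ⟨(hx x hxs).1, by
        simpa [eval_finsetSum] using (hx x hxs).2⟩
    exact ⟨x, hx, by rwa [_root_.iterate_derivative_sum] at hx0⟩
  obtain ⟨x, hx⟩ := h1.choice
  have hx1 : Tendsto x atTop (𝓝 1) :=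
    tendsto_of_tendsto_of_tendsto_of_le_of_le' ha tendsto_const_nhds
      (hx.mono fun j hj => hj.1.1) (hx.mono fun j hj => hj.1.2)
  have h2 : Tendsto (fun j => ∑ n, c j n * (derivative^[r] (h n)).eval (x j)) atTop
      (𝓝 (∑ n, c' n * (derivative^[r] (h n)).eval 1)) :=
    tendsto_finsetSum _ fun n _ => ((tendsto_pi_nhds.1 hc) n).mul
      (((derivative^[r] (h n)).continuous.tendsto 1).comp hx1)
  refine tendsto_nhds_unique h2 (tendsto_const_nhds.congr' ?_)
  exact hx.mono fun j hj => hj.2.symm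

/-- If `h n` vanishes at `1` to order exactly `n`, and `h M` has no zero in `[-1, 1)`, then some
linear combination of `h 0, …, h M` has in `[-1, 1]` exactly the zeros `1 - 2 (ε i) ^ 2`. -/
theorem exists_combination_zeros_eq_nodes (h : ℕ → ℝ[X]) (M : ℕ)
    (hne : ∀ n, h n ≠ 0) (hmul : ∀ n, (h n).rootMultiplicity 1 = n)
    (hM : ∀ v ∈ Set.Ico (-1 : ℝ) 1, (h M).eval v ≠ 0) {δ : ℝ} (hδ : 0 < δ) :
    ∃ ε, 0 < ε ∧ ε < δ ∧ ∃ c : Fin (M + 1) → ℝ, c (Fin.last M) ≠ 0 ∧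
      ∀ v ∈ Set.Icc (-1 : ℝ) 1, ∑ n, c n * (h n).eval v = 0 ↔ v ∈ nodes M ε := by
  open Filter Topology in
  by_contra! hcon
  set ε : ℕ → ℝ := fun j => δ / (j + 2) with hεdef
  have hε : ∀ j, 0 < ε j := fun j => by positivity
  have hεδ : ∀ j, ε j < δ := fun j => by
    have : (0 : ℝ) ≤ j := j.cast_nonneg
    exact div_lt_self hδ (by linarith)
  have hε0 : Tendsto ε atTop (𝓝 0) :=
    tendsto_const_nhds.div_atTop (tendsto_natCast_atTop_atTop.atTop_add tendsto_const_nhds)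
  -- Record the coefficients together with an unwanted extra zero. If the last coefficient vanishes,
  -- the second entry is a dummy 0; this case disappears in the limit.
  have hex : ∀ j, ∃ p : (Fin (M + 1) → ℝ) × ℝ, p ∈ Metric.sphere 0 1 ×ˢ Set.Icc (-1 : ℝ) 1 ∧
      (∀ x ∈ nodes M (ε j), ∑ n, p.1 n * (h n).eval x = 0) ∧
      (p.1 (Fin.last M) ≠ 0 → ∑ n, p.1 n * (h n).eval p.2 = 0 ∧ p.2 ∉ nodes M (ε j)) := by
    intro j
    obtain ⟨c, hc1, hc⟩ := exists_combination_eval_eq_zero h (nodes M (ε j))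
      (card_nodes M (hε j)).le
    by_cases hcM : c (Fin.last M) = 0
    · exact ⟨(c, 0), ⟨by simpa using hc1, by norm_num, by norm_num⟩, hc, fun h => absurd hcM h⟩
    · obtain ⟨v, hv, hv'⟩ := hcon (ε j) (hε j) (hεδ j) c hcM
      refine ⟨(c, v), ⟨by simpa using hc1, hv⟩, hc, fun _ => ?_⟩
      rcases hv' with h1 | h1
      · exact h1
      · exact absurd (hc v h1.2) h1.1
  choose p hp hnode hextra using hex
  obtain ⟨⟨c, w⟩, hcw, ψ, hψ, hlim⟩ :=
    ((isCompact_sphere (0 : Fin (M + 1) → ℝ) 1).prod (isCompact_Icc (a := (-1 : ℝ)) (b := 1))).tendsto_subseq hp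
  have hlimc : Tendsto (fun j => (p (ψ j)).1) atTop (𝓝 c) :=
    (continuous_fst.tendsto _).comp hlim
  have hlimw : Tendsto (fun j => (p (ψ j)).2) atTop (𝓝 w) :=
    (continuous_snd.tendsto _).comp hlim
  have hlima : Tendsto (fun j => 1 - 2 * (ε (ψ j) * M) ^ 2) atTop (𝓝 1) := by
    have := ((((hε0.comp hψ.tendsto_atTop).mul_const (M : ℝ)).pow 2).const_mul 2).const_sub 1
    simpa using this
  have hzero : ∀ i, i < M → ∑ n, c n * (derivative^[i] (h n)).eval 1 = 0 := fun i hi =>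
    sum_iterate_derivative_eq_zero_of_tendsto h hlimc hlima <| Eventually.of_forall fun j =>
      ⟨nodes M (ε (ψ j)), by rwa [card_nodes M (hε _)], fun x hx =>
        ⟨mem_Icc_of_mem_nodes (hε _) hx, hnode _ x hx⟩⟩
  have hlt : ∀ i n, i < n → (derivative^[i] (h n)).eval 1 = 0 := fun i n hin =>
    isRoot_iterate_derivative_of_lt_rootMultiplicity (by rwa [hmul n])
  have heq : ∀ n, (derivative^[n] (h n)).eval 1 ≠ 0 := by
    intro n h0
    have h1 : n < (h n).rootMultiplicity 1 := by
      rw [lt_rootMultiplicity_iff_isRoot_iterate_derivative (hne n)]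
      intro m hm
      rcases hm.lt_or_eq with h2 | rfl
      · exact hlt _ _ h2
      · exact h0
    rw [hmul n] at h1
    exact lt_irrefl _ h1
  have hsum : ∀ i, (hi : i < M + 1) → (∀ n : Fin (M + 1), (n : ℕ) < i → c n = 0) →
      ∑ n, c n * (derivative^[i] (h n)).eval 1 =
        c ⟨i, hi⟩ * (derivative^[i] (h i)).eval 1 := by
    intro i hi hc
    refine Finset.sum_eq_single_of_mem _ (Finset.mem_univ _) fun n _ hn => ?_
    rcases lt_trichotomy (n : ℕ) i with h1 | h1 | h1
    · rw [hc n h1, zero_mul]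
    · exact absurd (Fin.ext h1) hn
    · rw [hlt _ _ h1, mul_zero]
  -- The matrix of derivatives at 1 is triangular with nonzero diagonal, so the limit combination is
  -- a multiple of `h M`.
  have hc0 : ∀ i, ∀ n : Fin (M + 1), (n : ℕ) = i → i < M → c n = 0 := by
    intro i
    induction i using Nat.strong_induction_on with
    | _ i ih =>
      rintro n rfl hi
      have h1 := hsum n n.2 fun m hm => ih m hm m rfl (hm.trans hi)
      rw [hzero _ hi] at h1
      exact (mul_eq_zero.1 h1.symm).resolve_right (heq _)
  have hcM : c (Fin.last M) ≠ 0 := by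
    intro h0
    have h1 : c = 0 := by
      funext n
      rcases (Nat.lt_succ_iff.1 n.2).lt_or_eq with h2 | h2
      · exact hc0 _ n rfl h2
      · rw [show n = Fin.last M from Fin.ext h2, h0]; rfl
    have h2 := hcw.1
    simp [h1] at h2
  have hev : ∀ᶠ j in atTop, (p (ψ j)).1 (Fin.last M) ≠ 0 :=
    (tendsto_pi_nhds.1 hlimc (Fin.last M)).eventually_ne hcM
  have hw0 : ∑ n, c n * (h n).eval w = 0 := by
    have h2 : Tendsto (fun j => ∑ n, (p (ψ j)).1 n * (h n).eval (p (ψ j)).2) atTop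
        (𝓝 (∑ n, c n * (h n).eval w)) :=
      tendsto_finsetSum _ fun n _ => ((tendsto_pi_nhds.1 hlimc) n).mul
        (((h n).continuous.tendsto w).comp hlimw)
    exact tendsto_nhds_unique h2
      (tendsto_const_nhds.congr' (hev.mono fun j hj => (hextra _ hj).1.symm))
  -- The limit of the extra zeros is a zero of `h M`, which has none in [-1, 1).
  have hw1 : w = 1 := by
    by_contra hne1
    rw [Finset.sum_eq_single_of_mem (Fin.last M) (Finset.mem_univ _)] at hw0
    · exact mul_ne_zero hcM (hM w ⟨hcw.2.1, lt_of_le_of_ne hcw.2.2 hne1⟩) hw0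
    · intro n _ hn
      have h2 : (n : ℕ) < M := Fin.lt_last_iff_ne_last.2 hn
      rw [hc0 _ n rfl h2, zero_mul]
  subst hw1
  -- The nodes and the extra zero are M + 1 zeros tending to 1, so even the M-th derivative vanishes
  -- in the limit, a contradiction. The `min` allows for an extra zero to the left of all nodes.
  have hfin := sum_iterate_derivative_eq_zero_of_tendsto (r := M) h hlimc
    (a := fun j => min (p (ψ j)).2 (1 - 2 * (ε (ψ j) * M) ^ 2))
    (by simpa using hlimw.min hlima) (hev.mono fun j hj => by
      classical
      refine ⟨insert (p (ψ j)).2 (nodes M (ε (ψ j))), ?_, fun x hx => ?_⟩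
      · rw [Finset.card_insert_of_notMem (hextra _ hj).2, card_nodes M (hε _)]
        exact Nat.lt_succ_self M
      · rcases Finset.mem_insert.1 hx with rfl | hx
        · exact ⟨⟨min_le_left _ _, (hp _).2.2⟩, (hextra _ hj).1⟩
        · have h3 := mem_Icc_of_mem_nodes (hε _) hx
          exact ⟨⟨(min_le_right _ _).trans h3.1, h3.2⟩, hnode _ x hx⟩)
  rw [hsum M (Nat.lt_succ_self M) fun n hn => hc0 _ n rfl hn] at hfin
  exact mul_ne_zero hcM (heq M) hfin

/-! ### Crossings of the curve as zeros of a secant slope -/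

/-- The ordinate polynomial whose secant slopes on the ellipse `4 (s² + s t + t²) = 3` are governed
by `chebCombine A B`, see `eval_ordinatePoly_sub`. -/
noncomputable def ordinatePoly (A B : ℝ[X]) : ℝ[X] :=
  X ^ 2 * A.comp (1 - 2 * (4 * X ^ 3 - 3 * X) ^ 2) +
    (2 * X ^ 4 - 2 * X ^ 2) * B.comp (1 - 2 * (4 * X ^ 3 - 3 * X) ^ 2)

theorem eval_ordinatePoly_sub (A B : ℝ[X]) {s t : ℝ} (h : 4 * (s ^ 2 + s * t + t ^ 2) = 3) :
    (ordinatePoly A B).eval t - (ordinatePoly A B).eval s =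
      (t - s) * ((s + t) * (chebCombine A B).eval (1 - 2 * (s + t) ^ 2)) := by
  -- On the ellipse, s, t and -(s + t) are the roots of one equation T₃ = const, so A and B take
  -- equal values at all three.
  have hs : 4 * s ^ 3 - 3 * s = -(4 * (s + t) ^ 3 - 3 * (s + t)) := by
    linear_combination (2 * s + t) * h
  have ht : 4 * t ^ 3 - 3 * t = -(4 * (s + t) ^ 3 - 3 * (s + t)) := by
    linear_combination (s + 2 * t) * h
  rw [eval_chebCombine, show 4 * (1 - 2 * (s + t) ^ 2) ^ 3 - 3 * (1 - 2 * (s + t) ^ 2) =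
    1 - 2 * (4 * (s + t) ^ 3 - 3 * (s + t)) ^ 2 by ring]
  simp only [ordinatePoly, eval_add, eval_mul, eval_pow, eval_X, eval_comp, eval_sub, eval_one,
    eval_ofNat, hs, ht, neg_sq]
  generalize eval (1 - 2 * (4 * (s + t) ^ 3 - 3 * (s + t)) ^ 2) A = P
  generalize eval (1 - 2 * (4 * (s + t) ^ 3 - 3 * (s + t)) ^ 2) B = Q
  linear_combination (t - s) * (s + t) * Q * h

/-- The smaller of the two parameters with sum `u` on the ellipse `4 (s² + s t + t²) = 3`. -/
noncomputable def lowerParam (u : ℝ) : ℝ := (u - √(3 * (1 - u ^ 2))) / 2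

/-- The larger of the two parameters with sum `u` on the ellipse `4 (s² + s t + t²) = 3`. -/
noncomputable def upperParam (u : ℝ) : ℝ := (u + √(3 * (1 - u ^ 2))) / 2

theorem crossingParameters_ordinatePoly (A B : ℝ[X]) :
    crossingParameters (planeCurve (4 * X ^ 3 - 3 * X) (ordinatePoly A B)) =
      (fun u => (lowerParam u, upperParam u)) ''
        {u | u ∈ Set.Ioo (-1 : ℝ) 1 ∧ u * (chebCombine A B).eval (1 - 2 * u ^ 2) = 0} := by
  ext ⟨s, t⟩
  simp only [crossingParameters, planeCurve, Set.mem_ofPred_eq, Set.mem_image, Prod.mk.injEq]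
  simp only [eval_sub, eval_mul, eval_pow, eval_X, eval_ofNat]
  constructor
  · rintro ⟨hst, hx, hy⟩
    have hne : t - s ≠ 0 := by linarith
    have h : 4 * (s ^ 2 + s * t + t ^ 2) = 3 := by
      apply mul_left_cancel₀ hne
      linear_combination -hx
    have h1 := eval_ordinatePoly_sub A B h
    rw [hy, sub_self] at h1
    have hsq : 3 * (1 - (s + t) ^ 2) = (t - s) ^ 2 := by linear_combination -h
    have hpos : 0 < (t - s) ^ 2 := by positivity
    have hr : √(3 * (1 - (s + t) ^ 2)) = t - s := by
      rw [hsq, Real.sqrt_sq (by linarith)]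
    refine ⟨s + t, ⟨?_, ((mul_eq_zero.1 h1.symm).resolve_left hne)⟩, ?_, ?_⟩
    · exact abs_lt.1 ((sq_lt_one_iff_abs_lt_one _).1 (by linarith))
    · rw [lowerParam, hr]; ring
    · rw [upperParam, hr]; ring
  · rintro ⟨u, ⟨hu, h0⟩, rfl, rfl⟩
    have hu1 : 0 < 3 * (1 - u ^ 2) := by nlinarith [hu.1, hu.2]
    have hr := Real.sq_sqrt hu1.le
    have hr0 := Real.sqrt_pos.2 hu1
    unfold lowerParam upperParam
    set r := √(3 * (1 - u ^ 2))
    have h : 4 * (((u - r) / 2) ^ 2 + (u - r) / 2 * ((u + r) / 2) + ((u + r) / 2) ^ 2) = 3 := by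
      linear_combination hr
    have h1 := eval_ordinatePoly_sub A B h
    rw [show (u - r) / 2 + (u + r) / 2 = u by ring, h0, mul_zero] at h1
    refine ⟨by linarith, ?_, by linarith⟩
    linear_combination (-r) * h

/-! ### Ordering of the parameters and count of crossing points -/

theorem three_halves_le_sqrt {u : ℝ} (hu : u ∈ Set.Ioo (-(1 / 2) : ℝ) (1 / 2)) :
    3 / 2 ≤ √(3 * (1 - u ^ 2)) :=
  Real.le_sqrt_of_sq_le (by nlinarith [hu.1, hu.2])

/-- The slope of √(3(1 - u²)) has absolute value below 1 exactly for |u| < 1/2, which makes both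
parameters increase with u. -/
theorem abs_sqrt_sub_sqrt_lt {u v : ℝ} (hu : u ∈ Set.Ioo (-(1 / 2) : ℝ) (1 / 2))
    (hv : v ∈ Set.Ioo (-(1 / 2) : ℝ) (1 / 2)) (huv : u < v) :
    |√(3 * (1 - u ^ 2)) - √(3 * (1 - v ^ 2))| < v - u := by
  have h1 := three_halves_le_sqrt hu
  have h2 := three_halves_le_sqrt hv
  have h3 := Real.sq_sqrt (show 0 ≤ 3 * (1 - u ^ 2) by nlinarith [hu.1, hu.2])
  have h4 := Real.sq_sqrt (show 0 ≤ 3 * (1 - v ^ 2) by nlinarith [hv.1, hv.2])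
  set p := √(3 * (1 - u ^ 2))
  set q := √(3 * (1 - v ^ 2))
  have hpq : 0 < p + q := by linarith
  have h5 : (p - q) * (p + q) = 3 * (v - u) * (u + v) := by linear_combination h3 - h4
  have h6 : 0 < v - u := by linarith
  have h7 : 0 < (v - u) * (1 - (u + v)) := mul_pos h6 (by linarith [hu.2, hv.2])
  have h8 : 0 < (v - u) * (1 + (u + v)) := mul_pos h6 (by linarith [hu.1, hv.1])
  have h9 : (v - u) * 3 ≤ (v - u) * (p + q) := mul_le_mul_of_nonneg_left (by linarith) h6.le
  rw [abs_lt]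
  constructor
  · refine lt_of_mul_lt_mul_right ?_ hpq.le
    linarith
  · refine lt_of_mul_lt_mul_right ?_ hpq.le
    linarith

theorem strictMonoOn_lowerParam : StrictMonoOn lowerParam (Set.Ioo (-(1 / 2)) (1 / 2)) := by
  intro u hu v hv huv
  have := (abs_lt.1 (abs_sqrt_sub_sqrt_lt hu hv huv)).1
  unfold lowerParam; linarith

theorem strictMonoOn_upperParam : StrictMonoOn upperParam (Set.Ioo (-(1 / 2)) (1 / 2)) := by
  intro u hu v hv huv
  have := (abs_lt.1 (abs_sqrt_sub_sqrt_lt hu hv huv)).2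
  unfold upperParam; linarith

theorem lowerParam_lt_upperParam {u v : ℝ} (hu : u ∈ Set.Ioo (-(1 / 2) : ℝ) (1 / 2))
    (hv : v ∈ Set.Ioo (-(1 / 2) : ℝ) (1 / 2)) : lowerParam u < upperParam v := by
  have h1 := three_halves_le_sqrt hu
  have h2 := three_halves_le_sqrt hv
  unfold lowerParam upperParam; linarith [hu.2, hv.1]

theorem encard_crossingPoints {N : ℕ} {F : ℝ → ℝ × ℝ} {s t : Fin N → ℝ} (hs : StrictMono s)
    (hst : ∀ i j, s i < t j)
    (h : crossingParameters F = Set.range fun i => (s i, t i)) :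
    (crossingPoints F).encard = N := by
  have hpair : ∀ i, F (s i) = F (t i) := fun i => by
    have : (s i, t i) ∈ crossingParameters F := h ▸ Set.mem_range_self i
    exact this.2
  have hrange : crossingPoints F = Set.range (F ∘ s) := by
    ext P
    constructor
    · rintro ⟨a, b, hab, rfl, hb⟩
      have hmem : (a, b) ∈ crossingParameters F := ⟨hab, hb.symm⟩
      rw [h] at hmem
      obtain ⟨i, hi⟩ := hmem
      exact ⟨i, by rw [Function.comp, (Prod.mk.inj hi).1]⟩
    · rintro ⟨i, rfl⟩
      exact ⟨s i, t i, hst i i, rfl, (hpair i).symm⟩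
  -- No two crossings coincide: otherwise some s j would be the larger parameter of a pair, but all
  -- of those exceed every s.
  have hlt : ∀ i j, i < j → F (s i) ≠ F (s j) := by
    intro i j hij heq
    have hmem : (s i, s j) ∈ crossingParameters F := ⟨hs hij, heq⟩
    rw [h] at hmem
    obtain ⟨k, hk⟩ := hmem
    exact (hst j k).ne (Prod.mk.inj hk).2.symm
  have hinj : Function.Injective (F ∘ s) := by
    intro i j hij
    rcases lt_trichotomy i j with h1 | h1 | h1
    · exact absurd hij (hlt i j h1)
    · exact h1
    · exact absurd hij.symm (hlt j i h1)
  rw [hrange, ← Set.image_univ, hinj.encard_image, Set.encard_univ]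
  simp

/-! ### Degree of the ordinate -/

theorem natDegree_ordinatePoly {A B : ℝ[X]} {M : ℕ} (hA : ∀ i, M < 2 * i → A.coeff i = 0)
    (hB : ∀ i, M < 2 * i + 1 → B.coeff i = 0)
    (heven : Even M → A.coeff (M / 2) ≠ 0) (hodd : Odd M → B.coeff (M / 2) ≠ 0) :
    (ordinatePoly A B).natDegree = 2 * M + 2 * (M / 2) + 2 := by
  have hW : (1 - 2 * (4 * X ^ 3 - 3 * X) ^ 2 : ℝ[X]).natDegree = 6 := by
    rw [show (1 - 2 * (4 * X ^ 3 - 3 * X) ^ 2 : ℝ[X]) =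
      C (-32) * X ^ 6 + C 48 * X ^ 4 + C (-18) * X ^ 2 + C 1 by
        simp only [map_neg, map_ofNat, map_one]; ring]
    compute_degree!
  have hq : (2 * X ^ 4 - 2 * X ^ 2 : ℝ[X]).natDegree = 4 := by
    rw [show (2 * X ^ 4 - 2 * X ^ 2 : ℝ[X]) = C 2 * X ^ 4 + C (-2) * X ^ 2 by
        simp only [map_neg, map_ofNat]; ring]
    compute_degree!
  have hq0 : (2 * X ^ 4 - 2 * X ^ 2 : ℝ[X]) ≠ 0 := by
    intro h; rw [h] at hq; simp at hq
  have hcomp : ∀ P : ℝ[X], (P.comp (1 - 2 * (4 * X ^ 3 - 3 * X) ^ 2)).natDegree =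
      P.natDegree * 6 := fun P => by rw [natDegree_comp, hW]
  have hcomp0 : ∀ P : ℝ[X], P ≠ 0 → P.comp (1 - 2 * (4 * X ^ 3 - 3 * X) ^ 2) ≠ 0 := by
    intro P hP h
    rcases comp_eq_zero_iff.1 h with h1 | ⟨-, h1⟩
    · exact hP h1
    · rw [h1, natDegree_C] at hW; omega
  have hdA : A.natDegree ≤ M / 2 := natDegree_le_iff_coeff_eq_zero.2 fun i hi => hA i (by omega)
  have hdB : B.natDegree ≤ M / 2 := natDegree_le_iff_coeff_eq_zero.2 fun i hi => hB i (by omega)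
  rw [ordinatePoly]
  rcases Nat.even_or_odd M with hM | hM
  · have hcA := heven hM
    have hA0 : A ≠ 0 := fun h => hcA (by simp [h])
    have hdA' : A.natDegree = M / 2 := le_antisymm hdA (le_natDegree_of_ne_zero hcA)
    obtain ⟨k, rfl⟩ := hM
    have hd : (X ^ 2 * A.comp (1 - 2 * (4 * X ^ 3 - 3 * X) ^ 2)).natDegree =
        2 + (k + k) / 2 * 6 := by
      rw [natDegree_mul (pow_ne_zero 2 X_ne_zero) (hcomp0 A hA0), hcomp, hdA', natDegree_X_pow]
    rw [natDegree_add_eq_left_of_natDegree_lt, hd]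
    · omega
    · rw [hd]
      by_cases hB0 : B = 0
      · simp [hB0]
      · have : B.natDegree < k := by
          by_contra! h
          exact leadingCoeff_ne_zero.2 hB0 (hB _ (by omega))
        rw [natDegree_mul hq0 (hcomp0 B hB0), hcomp, hq]
        omega
  · have hcB := hodd hM
    have hB0 : B ≠ 0 := fun h => hcB (by simp [h])
    have hdB' : B.natDegree = M / 2 := le_antisymm hdB (le_natDegree_of_ne_zero hcB)
    obtain ⟨k, rfl⟩ := hM
    have hd : ((2 * X ^ 4 - 2 * X ^ 2) * B.comp (1 - 2 * (4 * X ^ 3 - 3 * X) ^ 2)).natDegree =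
        4 + (2 * k + 1) / 2 * 6 := by
      rw [natDegree_mul hq0 (hcomp0 B hB0), hcomp, hdB', hq]
    rw [natDegree_add_eq_right_of_natDegree_lt, hd]
    · omega
    · rw [hd]
      refine lt_of_le_of_lt natDegree_mul_le ?_
      rw [hcomp, natDegree_X_pow]
      omega

/-- The first components of `oscPair` combined with coefficients `c`. -/
noncomputable def combineFst {M : ℕ} (c : Fin (M + 1) → ℝ) : ℝ[X] :=
  ∑ n, C (c n) * (oscPair (oscSlope n) n).1

/-- The second components of `oscPair` combined with coefficients `c`. -/
noncomputable def combineSnd {M : ℕ} (c : Fin (M + 1) → ℝ) : ℝ[X] :=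
  ∑ n, C (c n) * (oscPair (oscSlope n) n).2

theorem eval_chebCombine_combine {M : ℕ} (c : Fin (M + 1) → ℝ) (v : ℝ) :
    (chebCombine (combineFst c) (combineSnd c)).eval v =
      ∑ n, c n * (oscPoly n).eval v := by
  simp only [oscPoly, eval_chebCombine, combineFst, combineSnd, eval_finsetSum, eval_mul, eval_C,
    Finset.mul_sum, ← Finset.sum_add_distrib]
  exact Finset.sum_congr rfl fun n _ => by ring

/-- Only the summand n = M reaches the top coefficient, which sits in A for even M and in B for odd
M. -/
theorem natDegree_ordinatePoly_combine {M : ℕ} {c : Fin (M + 1) → ℝ} (hc : c (Fin.last M) ≠ 0) :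
    (ordinatePoly (combineFst c) (combineSnd c)).natDegree = 2 * M + 2 * (M / 2) + 2 := by
  have hle : ∀ n : Fin (M + 1), (n : ℕ) ≤ M := fun n => Nat.lt_succ_iff.1 n.2
  apply natDegree_ordinatePoly
  · intro i hi
    simp only [combineFst, finsetSum_coeff, coeff_C_mul]
    exact Finset.sum_eq_zero fun n _ => by
      rw [(oscPair_coeff_eq_zero _ n).1 i ((hle n).trans_lt hi), mul_zero]
  · intro i hi
    simp only [combineSnd, finsetSum_coeff, coeff_C_mul]
    exact Finset.sum_eq_zero fun n _ => by
      rw [(oscPair_coeff_eq_zero _ n).2 i ((hle n).trans_lt hi), mul_zero]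
  · intro hM
    simp only [combineFst, finsetSum_coeff, coeff_C_mul]
    rw [Finset.sum_eq_single_of_mem (Fin.last M) (Finset.mem_univ _)]
    · refine mul_ne_zero hc ?_
      obtain ⟨k, rfl⟩ := hM
      have := (oscPair_leading_coeff (a := oscSlope (k + k))
        (by linarith [(oscSlope_mem (k + k)).2]) k).1
      rwa [Fin.val_last, show (k + k) / 2 = k by omega, show k + k = 2 * k by ring] at *
    · intro n _ hn
      have h2 : (n : ℕ) < M := Fin.lt_last_iff_ne_last.2 hn
      have := hM.two_dvd
      rw [(oscPair_coeff_eq_zero _ n).1 _ (by omega), mul_zero]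
  · intro hM
    simp only [combineSnd, finsetSum_coeff, coeff_C_mul]
    rw [Finset.sum_eq_single_of_mem (Fin.last M) (Finset.mem_univ _)]
    · refine mul_ne_zero hc ?_
      obtain ⟨k, rfl⟩ := hM
      have hs := (oscSlope_mem (2 * k + 1)).2
      have := oscPair_leading_coeff (a := oscSlope (2 * k + 1)) (by linarith) k
      rw [Fin.val_last, show (2 * k + 1) / 2 = k by omega, this.2]
      have hk : (0 : ℝ) ≤ k := k.cast_nonneg
      exact mul_ne_zero (by linarith) this.1
    · intro n _ hn
      have h2 : (n : ℕ) < M := Fin.lt_last_iff_ne_last.2 hn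
      have := Nat.odd_iff.1 hM
      rw [(oscPair_coeff_eq_zero _ n).2 _ (by omega), mul_zero]

/-! ### Assembly -/

theorem mul_eval_eq_zero_iff_of_nodes {M : ℕ} {ε : ℝ} {H : ℝ → ℝ}
    (hH : ∀ v ∈ Set.Icc (-1 : ℝ) 1, H v = 0 ↔ v ∈ nodes M ε) {u : ℝ}
    (hu : u ∈ Set.Ioo (-1 : ℝ) 1) :
    u * H (1 - 2 * u ^ 2) = 0 ↔ ∃ i : Fin (2 * M + 1), ε * ((i : ℝ) - M) = u := by
  have hv : 1 - 2 * u ^ 2 ∈ Set.Icc (-1 : ℝ) 1 := by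
    constructor <;> nlinarith [hu.1, hu.2]
  rw [mul_eq_zero, hH _ hv, nodes, Finset.mem_image]
  constructor
  · rintro (rfl | ⟨k, hk, hk'⟩)
    · exact ⟨⟨M, by omega⟩, by simp⟩
    · rw [Finset.mem_Icc] at hk
      have h1 : (ε * k) ^ 2 = u ^ 2 := by linarith
      rcases sq_eq_sq_iff_eq_or_eq_neg.1 h1 with h2 | h2
      · exact ⟨⟨M + k, by omega⟩, by push_cast; linarith⟩
      · refine ⟨⟨M - k, by omega⟩, ?_⟩
        rw [Nat.cast_sub hk.2]; linarith
  · rintro ⟨i, rfl⟩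
    have hi := i.2
    rcases lt_trichotomy (i : ℕ) M with h | h | h
    · refine Or.inr ⟨M - i, Finset.mem_Icc.2 ⟨by omega, by omega⟩, ?_⟩
      rw [Nat.cast_sub h.le]; ring
    · left; rw [h]; ring
    · refine Or.inr ⟨i - M, Finset.mem_Icc.2 ⟨by omega, by omega⟩, ?_⟩
      rw [Nat.cast_sub h.le]

theorem proposition3 (N : ℕ) (hN : Odd N) :
    ∃ x y : Polynomial ℝ,
      x.natDegree = 3 ∧
      y.natDegree = N + 2 * (N / 4) + 1 ∧
      (crossingPoints (planeCurve x y)).encard = N ∧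
      ∃ s t : Fin N → ℝ,
        StrictMono s ∧ StrictMono t ∧ (∀ i j, s i < t j) ∧
        crossingParameters (planeCurve x y) = Set.range (fun i => (s i, t i)) := by
  obtain ⟨M, rfl⟩ := hN
  -- The bound 1/(2M + 1) keeps every sum ε(i - M) inside (-1/2, 1/2), where the parameters are
  -- monotone.
  obtain ⟨ε, hε, hεM, c, hc, hzero⟩ := exists_combination_zeros_eq_nodes oscPoly M
    oscPoly_ne_zero rootMultiplicity_one_oscPoly (fun v hv => eval_oscPoly_ne_zero M hv)
    (δ := 1 / (2 * M + 1)) (by positivity)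
  simp only [← eval_chebCombine_combine] at hzero
  set u : Fin (2 * M + 1) → ℝ := fun i => ε * ((i : ℝ) - M) with hudef
  have hM0 : (0 : ℝ) ≤ M := M.cast_nonneg
  have hεM' : ε * M < 1 / 2 := by
    rw [lt_div_iff₀ (by positivity)] at hεM
    nlinarith
  have hu : ∀ i, u i ∈ Set.Ioo (-(1 / 2) : ℝ) (1 / 2) := by
    intro i
    have h1 : (i : ℝ) ≤ 2 * M := by exact_mod_cast Nat.lt_succ_iff.1 i.2
    have h2 : (0 : ℝ) ≤ i := Nat.cast_nonneg _
    simp only [hudef]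
    constructor <;> nlinarith
  have humono : StrictMono u := by
    intro i j hij
    have : (i : ℝ) < j := by exact_mod_cast hij
    simp only [hudef]
    nlinarith
  have hsmono : StrictMono (lowerParam ∘ u) := fun i j hij =>
    strictMonoOn_lowerParam (hu i) (hu j) (humono hij)
  have htmono : StrictMono (upperParam ∘ u) := fun i j hij =>
    strictMonoOn_upperParam (hu i) (hu j) (humono hij)
  have hst : ∀ i j, (lowerParam ∘ u) i < (upperParam ∘ u) j := fun i j =>
    lowerParam_lt_upperParam (hu i) (hu j)
  have hpar : crossingParameters (planeCurve (4 * X ^ 3 - 3 * X)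
      (ordinatePoly (combineFst c) (combineSnd c))) =
      Set.range fun i => ((lowerParam ∘ u) i, (upperParam ∘ u) i) := by
    rw [crossingParameters_ordinatePoly]
    ext p
    constructor
    · rintro ⟨w, ⟨hw, hw0⟩, rfl⟩
      obtain ⟨i, rfl⟩ := (mul_eval_eq_zero_iff_of_nodes
        (H := fun v => (chebCombine (combineFst c) (combineSnd c)).eval v) hzero hw).1 hw0
      exact ⟨i, rfl⟩
    · rintro ⟨i, rfl⟩
      have hw : u i ∈ Set.Ioo (-1 : ℝ) 1 := ⟨by linarith [(hu i).1], by linarith [(hu i).2]⟩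
      exact ⟨u i, ⟨hw, (mul_eval_eq_zero_iff_of_nodes
        (H := fun v => (chebCombine (combineFst c) (combineSnd c)).eval v) hzero hw).2
          ⟨i, rfl⟩⟩, rfl⟩
  refine ⟨4 * X ^ 3 - 3 * X, ordinatePoly (combineFst c) (combineSnd c), ?_, ?_,
    encard_crossingPoints hsmono hst hpar, _, _, hsmono, htmono, hst, hpar⟩
  · rw [show (4 * X ^ 3 - 3 * X : ℝ[X]) = C 4 * X ^ 3 + C (-3) * X by
        simp only [map_neg, map_ofNat]; ring]
    compute_degree!
  · rw [natDegree_ordinatePoly_combine hc]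
    omega
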